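/- Let $(X,\|\cdot\|)$ be a finite dimensional real normed space, let $m\in\{1,\dots,\dim X-1\}$, and let $\mathscr H^m$ denote the $m$-dimensional Hausdorff measure of $(X,\|\cdot\|)$. Let $\mathbf G_m(X)$ be the set of $m$-dimensional linear subspaces of $X$ and let $\mathrm{Hom}_m(X,X)$ be the set of linear maps $X\to X$ of rank at most $m$, with the topology induced by the operator norm. A density contractor on $W\in\mathbf G_m(X)$ is a Borel probability measure $\mu$ on $\mathrm{Hom}_m(X,X)$ such that (1) $\mu(\{\pi : \operatorname{im}\pi\not\subset W\})=0$, and (2) for every $V\in\mathbf G_m(X)$ and every Borel set $A\subset V$, $$\int_{\mathrm{Hom}_m(X,X)}\mathscr H^m(\pi(A))\,d\mu(\pi)\le\mathscr H^m(A),$$ with equality when $V=W$. Let $G$ be an Abelian group with a norm $|\cdot|_G$ for which it is a complete metric space. The group $\mathscr P_n(X,G)$ of polyhedral $G$-chains of dimension $n$ is the quotient of the group of finite formal sums $\sum_k g_k[\![\sigma_k]\!]$ of oriented (nondegenerate) $n$-simplices with coefficients in $G$ by the relations $g[\![-\sigma]\!]=-g[\![\sigma]\!]$, where $-\sigma$ is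 $\sigma$ with the opposite orientation, and $g[\![\sigma]\!]=\sum_j g[\![\tau_j]\!]$ whenever $\tau_1,\dots,\tau_r$ is a partition of $\sigma$ into nonoverlapping $n$-simplices with the same orientation as $\sigma$. The boundary of $\sum_k g_k[\![\sigma_k]\!]$ is the element $\sum_k\sum_{i=0}^m(-1)^i g_k[\![\sigma_{k,i}]\!]$ of $\mathscr P_{m-1}(X,G)$, where $\sigma_{k,i}$ is the face of the $m$-simplex $\sigma_k$ opposite to its $i$-th vertex. The triple $(X,G,m)$ satisfies the triangle inequality for cycles if, for all oriented $m$-simplices $\sigma_1,\dots,\sigma_\kappa$ in $X$ ($\kappa\ge1$) and all $g_1,\dots,g_\kappa\in G$, $$\partial\sum_{k=1}^{\kappa}g_k[\![\sigma_k]\!]=0\quad\Longrightarrow\quad |g_1|_G\,\mathscr H^m(\sigma_1)\le\sum_{k=2}^{\kappa}|g_k|_G\,\mathscr H^m(\sigma_k).$$ **Theorem.** If every $W\in\mathbf G_m(X)$ admits a density contractor, then for every complete normed Abelian group $G$ the triple $(X,G,m)$ satisfies the triangle inequality for cycles. -/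

import Mathlib

open MeasureTheory Set
open scoped ENNReal

noncomputable section

/-- The `m`-dimensional Hausdorff (outer) measure `ℋ^m` of the normed space `X`, normalized by the
factor `α(m) 2^{-m}`, where `α(m)` is the volume of the Euclidean unit ball of dimension `m`. -/
def normHausdorff (X : Type*) [NormedAddCommGroup X] [MeasurableSpace X] [BorelSpace X]
    (m : ℕ) : Measure X :=
  (volume (Metric.ball (0 : EuclideanSpace ℝ (Fin m)) 1) / 2 ^ m) • μH[(m : ℝ)]

/-- The Grassmannian `G_m(X)` of `m`-dimensional linear subspaces. -/
abbrev Grassmannian (X : Type*) [NormedAddCommGroup X] [NormedSpace ℝ X] (m : ℕ) : Type _ :=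
  {W : Submodule ℝ X // Module.finrank ℝ W = m}

/-- `Hom_m(X, X)`: the linear maps `X → X` of rank at most `m` (`X` will be finite dimensional),
with the topology and the Borel structure induced by the operator norm. -/
abbrev HomRankLE (X : Type*) [NormedAddCommGroup X] [NormedSpace ℝ X] (m : ℕ) : Type _ :=
  {π : X →L[ℝ] X // Module.finrank ℝ (π : X →ₗ[ℝ] X).range ≤ m}

/-- `μ` is a density contractor on `W ∈ G_m(X)`. -/
structure IsDensityContractor {X : Type*} [NormedAddCommGroup X] [NormedSpace ℝ X]
    [MeasurableSpace X] [BorelSpace X] {m : ℕ} (W : Grassmannian X m)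
    (μ : Measure (HomRankLE X m)) : Prop where
  isProbabilityMeasure : IsProbabilityMeasure μ
  supported : μ {π | ¬ (π.1 : X →ₗ[ℝ] X).range ≤ W.1} = 0
  contracts : ∀ V : Grassmannian X m, ∀ A : Set X, MeasurableSet A → A ⊆ V.1 →
    ∫⁻ π, normHausdorff X m (π.1 '' A) ∂μ ≤ normHausdorff X m A
  eq_on : ∀ A : Set X, MeasurableSet A → A ⊆ W.1 →
    ∫⁻ π, normHausdorff X m (π.1 '' A) ∂μ = normHausdorff X m A

/-- The relative interior of a simplex: all barycentric coordinates are positive.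
(`Affine.Simplex.interior` is not used since it is empty for a `0`-simplex.) -/
def Affine.Simplex.relInterior {X : Type*} [NormedAddCommGroup X] [NormedSpace ℝ X] {n : ℕ}
    (σ : Affine.Simplex ℝ X n) : Set X :=
  σ.setInterior (Ioi 0)

/-- `τ` lies in the affine `n`-plane of `σ` and the two `n`-simplices, oriented by the order of
their vertices, have the same orientation: the matrix of the barycentric coordinates
of the vertices of `τ` with respect to `σ` has positive determinant. -/
def Affine.Simplex.SameOrientation {X : Type*} [NormedAddCommGroup X] [NormedSpace ℝ X] {n : ℕ}
    (σ τ : Affine.Simplex ℝ X n) : Prop :=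
  ∃ M : Matrix (Fin (n + 1)) (Fin (n + 1)) ℝ,
    (∀ j, ∑ i, M j i = 1) ∧ (∀ j, τ.points j = ∑ i, M j i • σ.points i) ∧ 0 < M.det

/-- The simplices `τ₁, …, τ_r` form a partition of the simplex `σ` into nonoverlapping simplices
with the same orientation as `σ`. -/
structure Affine.Simplex.IsPartition {X : Type*} [NormedAddCommGroup X] [NormedSpace ℝ X]
    {n r : ℕ} (σ : Affine.Simplex ℝ X n) (τ : Fin r → Affine.Simplex ℝ X n) : Prop where
  iUnion_eq : ⋃ j, (τ j).closedInterior = σ.closedInterior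
  nonoverlapping : Pairwise fun j k => Disjoint (τ j).relInterior (τ k).relInterior
  sameOrientation : ∀ j, σ.SameOrientation (τ j)

/-- Formal sums of oriented `n`-simplices with coefficients in `G`. A simplex is given by its
ordered list of (affinely independent) vertices, which also orients it. -/
abbrev FormalChain (X G : Type*) [NormedAddCommGroup X] [NormedSpace ℝ X] [AddCommGroup G]
    (n : ℕ) : Type _ :=
  Affine.Simplex ℝ X n →₀ G

/-- The subgroup of formal sums identified with `0`: it is generated by the relations
`g ⟦x_{e(0)}, …, x_{e(n)}⟧ = sign(e) g ⟦x_0, …, x_n⟧` (change of orientation), and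
`g ⟦σ⟧ = ∑ j, g ⟦τ_j⟧` for the partitions of `σ` with the same orientation. -/
def chainRelations (X G : Type*) [NormedAddCommGroup X] [NormedSpace ℝ X] [AddCommGroup G]
    (n : ℕ) : AddSubgroup (FormalChain X G n) :=
  AddSubgroup.closure
    ({c | ∃ (g : G) (σ : Affine.Simplex ℝ X n) (e : Equiv.Perm (Fin (n + 1))),
        c = Finsupp.single (σ.reindex e) g
          - Finsupp.single σ ((Equiv.Perm.sign e : ℤ) • g)} ∪
     {c | ∃ (g : G) (σ : Affine.Simplex ℝ X n) (r : ℕ) (τ : Fin r → Affine.Simplex ℝ X n),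
        σ.IsPartition τ ∧
        c = Finsupp.single σ g - ∑ j, Finsupp.single (τ j) g})

/-- The group `𝒫_n(X, G)` of polyhedral `G` chains of dimension `n`. -/
abbrev PolyhedralChain (X G : Type*) [NormedAddCommGroup X] [NormedSpace ℝ X] [AddCommGroup G]
    (n : ℕ) : Type _ :=
  FormalChain X G n ⧸ chainRelations X G n

/-- The polyhedral chain `g ⟦σ⟧`. -/
def elementaryChain {X G : Type*} [NormedAddCommGroup X] [NormedSpace ℝ X] [AddCommGroup G]
    {n : ℕ} (g : G) (σ : Affine.Simplex ℝ X n) : PolyhedralChain X G n :=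
  QuotientAddGroup.mk (Finsupp.single σ g)

/-- The boundary `∂ (g ⟦σ⟧) = ∑ i, (-1)^i g ⟦σ_i⟧` in `𝒫_{m-1}(X, G)`, where `σ_i` is the face of
`σ` opposite to the `i`-th vertex, with the remaining vertices in their order. -/
def elementaryBoundary {X G : Type*} [NormedAddCommGroup X] [NormedSpace ℝ X] [AddCommGroup G]
    {m : ℕ} [NeZero m] (g : G) (σ : Affine.Simplex ℝ X m) : PolyhedralChain X G (m - 1) :=
  ∑ i : Fin (m + 1), elementaryChain (((-1 : ℤ) ^ (i : ℕ)) • g) (σ.faceOpposite i)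

/-- The Hausdorff mass `ℳ_H(g ⟦σ⟧) = ‖g‖ ℋ^m(σ)`. -/
def elementaryMass {X G : Type*} [NormedAddCommGroup X] [NormedSpace ℝ X] [MeasurableSpace X]
    [BorelSpace X] [NormedAddCommGroup G] {m : ℕ} (g : G) (σ : Affine.Simplex ℝ X m) : ℝ≥0∞ :=
  ‖g‖ₑ * normHausdorff X m σ.closedInterior

/-- The triple `(X, G, m)` satisfies the triangle inequality for cycles: whenever the polyhedral
chain `g₀ ⟦σ₀⟧ + ⋯ + g_κ ⟦σ_κ⟧` has boundary zero, the mass of `g₀ ⟦σ₀⟧` is at most the sum of the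
masses of the other `g_k ⟦σ_k⟧`. -/
def TriangleInequalityForCycles (X G : Type*) [NormedAddCommGroup X] [NormedSpace ℝ X]
    [MeasurableSpace X] [BorelSpace X] [NormedAddCommGroup G] (m : ℕ) [NeZero m] : Prop :=
  ∀ (κ : ℕ) (σ : Fin (κ + 1) → Affine.Simplex ℝ X m) (g : Fin (κ + 1) → G),
    ∑ k, elementaryBoundary (g k) (σ k) = 0 →
    elementaryMass (g 0) (σ 0) ≤ ∑ k : Fin κ, elementaryMass (g k.succ) (σ k.succ)

end

/-! Take a density contractor on the direction `W` of the first simplex. Almost every `π` maps into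
`W`, where `ℋ^m` is a Haar measure in linear coordinates. If each linear image of the cycle in `ℝ^m`
satisfies the inequality (`enorm_mul_measure_image_le_sum`), integrating over `π` finishes: the
first simplex gives equality, the others can only lose area.

In `ℝ^m` a cycle of top dimension has zero multiplicity almost everywhere
(`ae_sum_coneIndex_smul_eq_zero`). The signed indicator of a simplex is almost everywhere the
alternating sum of the signed cones over its faces from a fixed apex. Coning is additive on formal
chains and respects the defining relations almost everywhere, so the cone over a zero boundary
vanishes. The norm of `G` applied pointwise then bounds the first term by the others. In homogeneous
coordinates simplices become linear cones, and the coning identity is a statement about `N + 1`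
vectors of `ℝ^N` (`sum_coneIndex_succAbove`). -/

/-! ### Signed cones and the circuit relation -/

/-- The convex cone generated by a finite family of vectors. -/
def nonnegCone {ι E : Type*} [Fintype ι] [AddCommGroup E] [Module ℝ E] (w : ι → E) : Set E :=
  {y | ∃ c : ι → ℝ, 0 ≤ c ∧ ∑ i, c i • w i = y}

open Classical in
/-- The indicator function of the cone generated by `N` vectors of `ℝ^N`, multiplied by the
orientation of these vectors. -/
noncomputable def coneIndex {N : ℕ} (w : Fin N → Fin N → ℝ) (y : Fin N → ℝ) : ℤ :=
  if y ∈ nonnegCone w then (SignType.sign (Matrix.det w) : ℤ) else 0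

/-- Along a line in the space of coefficients, exactly one face of the nonnegative orthant is
crossed at the point where the orthant is entered. -/
lemma sum_ite_entered_face {ι E : Type*} [Fintype ι] [AddCommGroup E] [Module ℝ E]
    {q : ι → E} {d : ι → ℝ} {y : E} (hd : ∑ i, d i • q i = 0)
    (hsum : ∑ i, d i = 0) (hd0 : d ≠ 0)
    (hker : ∀ c : ι → ℝ, ∑ i, c i • q i = 0 → ∃ t : ℝ, c = t • d)
    (hgen : ∀ i j, i ≠ j → y ∉ Submodule.span ℝ (q '' {i, j}ᶜ))
    [∀ i, Decidable (∃ c : ι → ℝ, 0 ≤ c ∧ c i = 0 ∧ ∑ j, c j • q j = y)]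
    [Decidable (y ∈ nonnegCone q)] :
    ∑ i, (if 0 < d i ∧ ∃ c : ι → ℝ, 0 ≤ c ∧ c i = 0 ∧ ∑ j, c j • q j = y then (1 : ℤ) else 0)
      = if y ∈ nonnegCone q then 1 else 0 := by
  classical
  by_cases hy : y ∈ nonnegCone q
  · rw [if_pos hy]
    obtain ⟨c, hc, hcy⟩ := hy
    have hpos : ∃ i, 0 < d i := by
      by_contra! h
      refine hd0 (funext fun i => ?_)
      have := (Finset.sum_eq_zero_iff_of_nonpos (fun i _ => h i)).1 hsum i (Finset.mem_univ i)
      simpa using this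
    -- Moving from `c` along `-d`, the first coordinate to vanish minimizes `c i / d i` among those
    -- with `0 < d i`.
    obtain ⟨i₀, hi₀, hmin⟩ := Finset.exists_min_image (Finset.univ.filter fun i => 0 < d i)
      (fun i => c i / d i) (by simpa [Finset.Nonempty] using hpos)
    simp only [Finset.mem_filter, Finset.mem_univ, true_and] at hi₀ hmin
    have hface : ∃ c : ι → ℝ, 0 ≤ c ∧ c i₀ = 0 ∧ ∑ j, c j • q j = y := by
      refine ⟨fun j => c j - c i₀ / d i₀ * d j, fun j => ?_, ?_, ?_⟩
      · show 0 ≤ c j - c i₀ / d i₀ * d j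
        rcases lt_or_ge 0 (d j) with hj | hj
        · have := hmin j hj
          rw [le_div_iff₀ hj] at this
          linarith
        · have h1 : 0 ≤ c i₀ / d i₀ := div_nonneg (hc i₀) hi₀.le
          have := mul_nonpos_of_nonneg_of_nonpos h1 hj
          have := hc j
          simp only [Pi.zero_apply] at this
          linarith
      · field_simp
        simp
      · simp only [sub_smul, Finset.sum_sub_distrib, mul_smul, ← Finset.smul_sum, hd, hcy,
          smul_zero, sub_zero]
    rw [Finset.sum_eq_single i₀, if_pos ⟨hi₀, hface⟩]
    · rintro i - hne
      refine if_neg ?_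
      rintro ⟨hi, a, ha, hai, hay⟩
      obtain ⟨b, hb, hbi, hby⟩ := hface
      -- Two entry points differ by `t • d`. Coordinate `i` forces `t ≤ 0` and `i₀` forces `0 ≤ t`,
      -- so they coincide and two coefficients vanish, against genericity.
      obtain ⟨t, ht⟩ := hker (a - b) (by
        simp [sub_smul, Finset.sum_sub_distrib, hay, hby])
      have h1 : a i - b i = t * d i := by simpa using congrFun ht i
      have h2 : a i₀ - b i₀ = t * d i₀ := by simpa using congrFun ht i₀
      have h3 := hb i
      have h4 := ha i₀
      simp only [Pi.zero_apply] at h3 h4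
      have ht0 : t = 0 := by
        apply le_antisymm
        · by_contra! h
          have := mul_pos h hi
          linarith
        · by_contra! h
          have := mul_neg_of_neg_of_pos h hi₀
          linarith
      have hai₀ : a i₀ = 0 := by rw [ht0] at h2; linarith
      refine hgen i i₀ hne ?_
      rw [← hay]
      refine Submodule.sum_mem _ fun j _ => ?_
      by_cases hj : j = i ∨ j = i₀
      · have : a j = 0 := by rcases hj with rfl | rfl <;> assumption
        simp [this]
      · exact Submodule.smul_mem _ _ (Submodule.subset_span ⟨j, by simpa using hj, rfl⟩)
    · simp
  · rw [if_neg hy]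
    refine Finset.sum_eq_zero fun i _ => if_neg ?_
    rintro ⟨-, c, hc, -, hcy⟩
    exact hy ⟨c, hc, hcy⟩

/-- Coordinate `k` of the sum is the expansion along the first column of a determinant in which
column `k` of `q` occurs twice. -/
lemma sum_det_succAbove_smul_eq_zero {N : ℕ} (q : Fin (N + 1) → Fin N → ℝ) :
    ∑ i : Fin (N + 1), ((-1) ^ (i : ℕ) * Matrix.det (fun j => q (i.succAbove j))) • q i = 0 := by
  ext k
  have h := Matrix.det_succ_column_zero (Matrix.of fun i : Fin (N + 1) =>
    (Fin.cons (q i k) (q i) : Fin (N + 1) → ℝ))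
  rw [Matrix.det_zero_of_column_eq (i := 0) (j := k.succ) (Fin.succ_ne_zero k).symm
    (by simp)] at h
  simp only [Finset.sum_apply, Pi.smul_apply, smul_eq_mul, Pi.zero_apply]
  rw [h]
  refine Finset.sum_congr rfl fun i _ => ?_
  simp only [Matrix.of_apply, Fin.cons_zero]
  rw [mul_right_comm]
  rfl

lemma eq_zero_of_sum_smul_eq_zero {N : ℕ} {w : Fin N → Fin N → ℝ} (hw : Matrix.det w ≠ 0)
    {c : Fin N → ℝ} (hc : ∑ i, c i • w i = 0) : c = 0 := by
  refine Matrix.eq_zero_of_vecMul_eq_zero (M := w) hw ?_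
  rw [← hc]
  ext k
  simp [Matrix.vecMul, dotProduct]

lemma mem_nonnegCone_succAbove {N : ℕ} {E : Type*} [AddCommGroup E] [Module ℝ E]
    (q : Fin (N + 1) → E) (i : Fin (N + 1)) (y : E) :
    y ∈ nonnegCone (fun j => q (i.succAbove j)) ↔
      ∃ c : Fin (N + 1) → ℝ, 0 ≤ c ∧ c i = 0 ∧ ∑ j, c j • q j = y := by
  constructor
  · rintro ⟨c, hc, hy⟩
    refine ⟨i.insertNth 0 c, ?_, by simp, ?_⟩
    · intro j
      refine Fin.succAboveCases i ?_ (fun j => ?_) j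
      · simp
      · simpa using hc j
    · rw [Fin.sum_univ_succAbove _ i]
      simpa using hy
  · rintro ⟨c, hc, hi, hy⟩
    refine ⟨fun j => c (i.succAbove j), fun j => hc _, ?_⟩
    rw [← hy, Fin.sum_univ_succAbove _ i, hi]
    simp

/-- The oriented indicator functions of the facets of a pointed circuit add up to zero. -/
lemma sum_coneIndex_succAbove {N : ℕ} (q : Fin (N + 1) → Fin N → ℝ) (y : Fin N → ℝ)
    (ℓ : (Fin N → ℝ) →ₗ[ℝ] ℝ) (hℓ : ∀ i, ℓ (q i) = 1)
    (hgen : ∀ i j, i ≠ j → y ∉ Submodule.span ℝ (q '' {i, j}ᶜ)) :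
    ∑ i : Fin (N + 1), (-1) ^ (i : ℕ) * coneIndex (fun j => q (i.succAbove j)) y = 0 := by
  classical
  set d : Fin (N + 1) → ℝ := fun i =>
    (-1) ^ (i : ℕ) * Matrix.det (fun j => q (i.succAbove j)) with hd_def
  have hd : ∑ i, d i • q i = 0 := sum_det_succAbove_smul_eq_zero q
  -- Since all `q i` lie on the hyperplane `ℓ = 1`, a nonzero `d` has entries of both signs, so the
  -- line of solutions both enters and leaves the orthant.
  have hsum : ∑ i, d i = 0 := by simpa [hℓ] using congrArg ℓ hd
  have hterm : ∀ i : Fin (N + 1), (-1) ^ (i : ℕ) * coneIndex (fun j => q (i.succAbove j)) y =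
      if y ∈ nonnegCone (fun j => q (i.succAbove j)) then (SignType.sign (d i) : ℤ) else 0 := by
    intro i
    simp only [coneIndex, hd_def, mul_ite, mul_zero]
    congr 1
    rcases Nat.even_or_odd (i : ℕ) with h | h <;> simp [h.neg_one_pow, Left.sign_neg]
  simp only [hterm]
  by_cases hd0 : d = 0
  · simp [hd0]
  obtain ⟨i₀, hi₀⟩ : ∃ i, d i ≠ 0 := by simpa [funext_iff] using hd0
  have hdet : Matrix.det (fun j => q (i₀.succAbove j)) ≠ 0 := fun h => hi₀ (by simp [hd_def, h])
  have hker : ∀ c : Fin (N + 1) → ℝ, ∑ i, c i • q i = 0 → ∃ t : ℝ, c = t • d := by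
    intro c hc
    refine ⟨c i₀ / d i₀, ?_⟩
    have h1 : c i₀ - c i₀ / d i₀ * d i₀ = 0 := by field_simp; simp
    have h2 : ∑ i, (c i - c i₀ / d i₀ * d i) • q i = 0 := by
      simp only [sub_smul, Finset.sum_sub_distrib, mul_smul, ← Finset.smul_sum, hd, hc]
      simp
    rw [Fin.sum_univ_succAbove _ i₀, h1, zero_smul, zero_add] at h2
    have h3 := eq_zero_of_sum_smul_eq_zero hdet h2
    funext i
    refine Fin.succAboveCases i₀ ?_ (fun j => ?_) i
    · simpa [sub_eq_zero] using h1
    · simpa [sub_eq_zero] using congrFun h3 j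
  -- The entry face along `-d` is the exit face along `d`; they carry opposite signs and cancel.
  have hp := sum_ite_entered_face hd hsum hd0 hker hgen
  have hn := sum_ite_entered_face (d := -d) (y := y) (q := q) (by simp [hd])
    (by simp [hsum]) (by simpa using hd0)
    (fun c hc => by
      obtain ⟨t, ht⟩ := hker c hc
      exact ⟨-t, by simp [ht]⟩) hgen
  refine Eq.trans ?_ (sub_eq_zero.2 (hp.trans hn.symm))
  rw [← Finset.sum_sub_distrib]
  refine Finset.sum_congr rfl fun i _ => ?_
  simp only [mem_nonnegCone_succAbove, Pi.neg_apply, Left.neg_pos_iff]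
  by_cases hF : ∃ c : Fin (N + 1) → ℝ, 0 ≤ c ∧ c i = 0 ∧ ∑ j, c j • q j = y
  · simp only [hF, and_true, if_true]
    rcases lt_trichotomy (d i) 0 with h | h | h
    · simp [h, h.not_gt]
    · simp [h]
    · simp [h, h.not_gt]
  · simp [hF]

lemma nonnegCone_comp_equiv {ι E : Type*} [Fintype ι] [AddCommGroup E] [Module ℝ E] (w : ι → E)
    (e : ι ≃ ι) : nonnegCone (w ∘ e) = nonnegCone w := by
  have key : ∀ (w : ι → E) (e : ι ≃ ι), nonnegCone (w ∘ e) ⊆ nonnegCone w := by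
    rintro w e y ⟨c, hc, hy⟩
    refine ⟨c ∘ e.symm, fun i => hc (e.symm i), ?_⟩
    rw [← hy, ← e.sum_comp]
    simp
  refine (key w e).antisymm ?_
  have h := key (w ∘ e) e.symm
  rwa [Function.comp_assoc, e.self_comp_symm, Function.comp_id] at h

lemma mem_nonnegCone_cons {n : ℕ} {E : Type*} [AddCommGroup E] [Module ℝ E] (o : E)
    (v : Fin n → E) (y : E) :
    y ∈ nonnegCone (Fin.cons o v : Fin (n + 1) → E) ↔
      ∃ (s : ℝ) (c : Fin n → ℝ), 0 ≤ s ∧ 0 ≤ c ∧ s • o + ∑ i, c i • v i = y := by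
  constructor
  · rintro ⟨c, hc, hy⟩
    refine ⟨c 0, fun i => c i.succ, hc 0, fun i => hc _, ?_⟩
    simpa [Fin.sum_univ_succ] using hy
  · rintro ⟨s, c, hs, hc, hy⟩
    refine ⟨Fin.cons s c, fun i => ?_, ?_⟩
    · refine Fin.cases hs (fun i => hc i) i
    · simpa [Fin.sum_univ_succ] using hy

lemma det_cons_comp_perm {n : ℕ} (o : Fin (n + 1) → ℝ) (v : Fin n → Fin (n + 1) → ℝ)
    (e : Equiv.Perm (Fin n)) :
    Matrix.det (Fin.cons o (v ∘ e) : Fin (n + 1) → Fin (n + 1) → ℝ) =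
      ((Equiv.Perm.sign e : ℤ) : ℝ) *
        Matrix.det (Fin.cons o v : Fin (n + 1) → Fin (n + 1) → ℝ) := by
  have := ((Matrix.detRowAlternating (n := Fin (n + 1)) (R := ℝ)).curryLeft o).map_perm v e
  simp only [AlternatingMap.curryLeft_apply_apply] at this
  rw [Units.smul_def, zsmul_eq_mul] at this
  exact this

/-- With the first row fixed, the determinant is an alternating `n`-form in the coefficient rows,
hence a multiple of the determinant on `ℝ^n`. -/
lemma det_cons_sum_smul {n : ℕ} (o : Fin (n + 1) → ℝ) (v : Fin n → Fin (n + 1) → ℝ)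
    (M : Matrix (Fin n) (Fin n) ℝ) :
    Matrix.det (Fin.cons o (fun j => ∑ i, M j i • v i) : Fin (n + 1) → Fin (n + 1) → ℝ) =
      M.det * Matrix.det (Fin.cons o v : Fin (n + 1) → Fin (n + 1) → ℝ) := by
  set f := ((Matrix.detRowAlternating (n := Fin (n + 1)) (R := ℝ)).curryLeft o).compLinearMap
    (Fintype.linearCombination ℝ v) with hf
  have h := DFunLike.congr_fun (f.eq_smul_basis_det (Pi.basisFun ℝ (Fin n))) fun j i => M j i
  have h1 : f (fun j i => M j i) =
      Matrix.det (Fin.cons o (fun j => ∑ i, M j i • v i) : Fin (n + 1) → Fin (n + 1) → ℝ) := rfl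
  have h2 : f (Pi.basisFun ℝ (Fin n)) =
      Matrix.det (Fin.cons o v : Fin (n + 1) → Fin (n + 1) → ℝ) := by
    rw [hf, AlternatingMap.compLinearMap_apply, AlternatingMap.curryLeft_apply_apply]
    congr 2
    funext j
    simp [Fintype.linearCombination_apply, Pi.single_apply]
  rw [← h1]
  refine h.trans ?_
  rw [AlternatingMap.smul_apply, h2, Pi.basisFun_det, smul_eq_mul, mul_comm]
  rfl

lemma coneIndex_cons_comp_perm {n : ℕ} (o : Fin (n + 1) → ℝ) (v : Fin n → Fin (n + 1) → ℝ)
    (e : Equiv.Perm (Fin n)) (y : Fin (n + 1) → ℝ) :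
    coneIndex (Fin.cons o (v ∘ e)) y = (Equiv.Perm.sign e : ℤ) * coneIndex (Fin.cons o v) y := by
  have hmem : y ∈ nonnegCone (Fin.cons o (v ∘ e) : Fin (n + 1) → Fin (n + 1) → ℝ) ↔
      y ∈ nonnegCone (Fin.cons o v : Fin (n + 1) → Fin (n + 1) → ℝ) := by
    simp only [mem_nonnegCone_cons]
    constructor
    · rintro ⟨s, c, hs, hc, hy⟩
      obtain ⟨c', hc', hy'⟩ := (nonnegCone_comp_equiv v e).subset ⟨c, hc, rfl⟩
      exact ⟨s, c', hs, hc', by rw [hy']; exact hy⟩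
    · rintro ⟨s, c, hs, hc, hy⟩
      obtain ⟨c', hc', hy'⟩ := (nonnegCone_comp_equiv v e).superset ⟨c, hc, rfl⟩
      exact ⟨s, c', hs, hc', by rw [hy']; exact hy⟩
  simp only [coneIndex, mul_ite, mul_zero, det_cons_comp_perm]
  by_cases hy : y ∈ nonnegCone (Fin.cons o v : Fin (n + 1) → Fin (n + 1) → ℝ)
  · rw [if_pos (hmem.2 hy), if_pos hy]
    rcases Int.units_eq_one_or (Equiv.Perm.sign e) with h | h <;> simp [h, Left.sign_neg]
  · rw [if_neg (mt hmem.1 hy), if_neg hy]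

/-! ### Homogeneous coordinates and general position -/

/-- Homogeneous coordinates of a point of `ℝ^m`. -/
noncomputable def homogenize {m : ℕ} (y : Fin m → ℝ) : Fin (m + 1) → ℝ := Fin.cons 1 y

lemma homogenize_sum_smul {ι : Type*} [Fintype ι] {m : ℕ} {c : ι → ℝ} (hc : ∑ i, c i = 1)
    (p : ι → Fin m → ℝ) : homogenize (∑ i, c i • p i) = ∑ i, c i • homogenize (p i) := by
  ext j
  refine Fin.cases ?_ (fun j => ?_) j <;> simp [homogenize, hc]

lemma homogenize_injective {m : ℕ} : Function.Injective (homogenize (m := m)) :=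
  Fin.cons_right_injective (α := fun _ => ℝ) (1 : ℝ)

/-- Almost every point avoids the span of fewer than `m + 1` vectors. -/
lemma ae_homogenize_notMem_span {m : ℕ} (ν : Measure (Fin m → ℝ)) [ν.IsAddHaarMeasure]
    {ι : Type*} [Finite ι] (q : ι → Fin (m + 1) → ℝ) (S : Set ι) (hS : S.ncard ≤ m) :
    ∀ᵐ y ∂ν, homogenize y ∉ Submodule.span ℝ (q '' S) := by
  classical
  set U := Submodule.span ℝ (q '' S)
  have hU : U ≠ ⊤ := by
    intro h
    have h1 : Module.finrank ℝ U ≤ m := by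
      have : Fintype (q '' S) := Fintype.ofFinite _
      refine (finrank_span_le_card (q '' S)).trans ?_
      rw [← Set.ncard_eq_toFinset_card']
      exact (Set.ncard_image_le (Set.toFinite S)).trans hS
    rw [h, finrank_top] at h1
    simp at h1
  let A : (Fin m → ℝ) →ᵃ[ℝ] (Fin (m + 1) → ℝ) :=
    { toFun := homogenize
      linear := LinearMap.pi (Fin.cons 0 fun j => LinearMap.proj j)
      map_vadd' := fun p v => by
        ext j
        refine Fin.cases ?_ (fun j => ?_) j <;> simp [homogenize] }
  have hne : U.toAffineSubspace.comap A ≠ ⊤ := by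
    intro h
    have h1 : ∀ y, homogenize y ∈ U := fun y => by
      have : y ∈ U.toAffineSubspace.comap A := h ▸ AffineSubspace.mem_top ℝ _ y
      exact this
    refine hU (eq_top_iff.2 fun z _ => ?_)
    -- The slice at height one spans the whole space, so a proper subspace cuts it in a proper
    -- affine subspace, which is Haar null.
    have hz : z = homogenize (fun j => z j.succ) + (z 0 - 1) • homogenize 0 := by
      ext j
      refine Fin.cases ?_ (fun j => ?_) j <;> simp [homogenize]
    rw [hz]
    exact U.add_mem (h1 _) (U.smul_mem _ (h1 _))
  have h0 := Measure.addHaar_affineSubspace ν _ hne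
  simp only [ae_iff, not_not]
  exact h0

/-! ### Cones over simplices, partitions and faces -/

section Simplex

variable {X : Type*} [NormedAddCommGroup X] [NormedSpace ℝ X]

lemma Affine.Simplex.mem_setInterior_iff {n : ℕ} {τ : Affine.Simplex ℝ X n} {I : Set ℝ} {x : X} :
    x ∈ τ.setInterior I ↔
      ∃ c : Fin (n + 1) → ℝ, ∑ i, c i = 1 ∧ (∀ i, c i ∈ I) ∧ ∑ i, c i • τ.points i = x := by
  refine exists_congr fun c => and_congr_right fun hc => and_congr_right fun _ => ?_
  rw [Finset.affineCombination_eq_linear_combination _ _ _ hc]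

lemma Affine.Simplex.mem_closedInterior_iff {n : ℕ} {τ : Affine.Simplex ℝ X n} {x : X} :
    x ∈ τ.closedInterior ↔
      ∃ c : Fin (n + 1) → ℝ, ∑ i, c i = 1 ∧ 0 ≤ c ∧ ∑ i, c i • τ.points i = x := by
  rw [Affine.Simplex.closedInterior, mem_setInterior_iff]
  refine exists_congr fun c => and_congr_right fun hc => and_congr_left fun _ => ?_
  refine ⟨fun h i => (h i).1, fun h i => ⟨h i, ?_⟩⟩
  rw [← hc]
  exact Finset.single_le_sum (fun j _ => h j) (Finset.mem_univ i)

lemma Affine.Simplex.relInterior_subset_closedInterior {n : ℕ} (τ : Affine.Simplex ℝ X n) :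
    τ.relInterior ⊆ τ.closedInterior := by
  intro x hx
  obtain ⟨c, hc, h0, rfl⟩ := Affine.Simplex.mem_setInterior_iff.1 hx
  exact Affine.Simplex.mem_closedInterior_iff.2 ⟨c, hc, fun i => le_of_lt (h0 i), rfl⟩

/-- The homogeneous coordinates of the images of the vertices of a simplex. -/
noncomputable def homVertices {m n : ℕ} (L : X →ₗ[ℝ] Fin m → ℝ) (τ : Affine.Simplex ℝ X n) :
    Fin (n + 1) → Fin (m + 1) → ℝ :=
  fun i => homogenize (L (τ.points i))

variable {m n : ℕ} (L : X →ₗ[ℝ] Fin m → ℝ) (τ : Affine.Simplex ℝ X n)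

lemma homogenize_map_sum_smul {c : Fin (n + 1) → ℝ} (hc : ∑ i, c i = 1) :
    homogenize (L (∑ i, c i • τ.points i)) = ∑ i, c i • homVertices L τ i := by
  rw [map_sum]
  simp only [map_smul]
  exact homogenize_sum_smul hc _

/-- The zeroth coordinate forces the cone coefficients to sum to one, so they are barycentric
coordinates. -/
lemma homogenize_mem_nonnegCone_homVertices {y : Fin m → ℝ} :
    homogenize y ∈ nonnegCone (homVertices L τ) ↔ y ∈ L '' τ.closedInterior := by
  constructor
  · rintro ⟨c, hc, hy⟩
    have h1 : ∑ i, c i = 1 := by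
      simpa [homVertices, homogenize] using congrFun hy 0
    refine ⟨_, Affine.Simplex.mem_closedInterior_iff.2 ⟨c, h1, hc, rfl⟩, ?_⟩
    apply homogenize_injective
    rw [homogenize_map_sum_smul L τ h1, hy]
  · rintro ⟨x, hx, rfl⟩
    obtain ⟨c, h1, hc, rfl⟩ := Affine.Simplex.mem_closedInterior_iff.1 hx
    exact ⟨c, hc, (homogenize_map_sum_smul L τ h1).symm⟩

lemma mem_cone_of_mem_closedInterior {o : Fin (m + 1) → ℝ} {s t : ℝ} {x : X} (hs : 0 ≤ s)
    (ht : 0 ≤ t) (hx : x ∈ τ.closedInterior) :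
    s • o + t • homogenize (L x) ∈
      nonnegCone (Fin.cons o (homVertices L τ) : Fin (n + 2) → Fin (m + 1) → ℝ) := by
  obtain ⟨c, h1, hc, rfl⟩ := Affine.Simplex.mem_closedInterior_iff.1 hx
  refine (mem_nonnegCone_cons _ _ _).2 ⟨s, t • c, hs, smul_nonneg ht hc, ?_⟩
  rw [homogenize_map_sum_smul L τ h1, Finset.smul_sum]
  simp [mul_smul]

lemma exists_mem_closedInterior_of_mem_cone {o z : Fin (m + 1) → ℝ}
    (hz : z ∈ nonnegCone (Fin.cons o (homVertices L τ) : Fin (n + 2) → Fin (m + 1) → ℝ))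
    (hzo : z ∉ Submodule.span ℝ {o}) :
    ∃ s t : ℝ, ∃ x ∈ τ.closedInterior, 0 ≤ s ∧ 0 < t ∧ s • o + t • homogenize (L x) = z := by
  obtain ⟨s, c, hs, hc, rfl⟩ := (mem_nonnegCone_cons _ _ _).1 hz
  have ht : 0 < ∑ i, c i := by
    refine lt_of_le_of_ne (Finset.sum_nonneg fun i _ => hc i) fun h => hzo ?_
    have h0 := (Finset.sum_eq_zero_iff_of_nonneg fun i _ => hc i).1 h.symm
    rw [Finset.sum_eq_zero fun i hi => by rw [h0 i hi, zero_smul], add_zero]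
    exact Submodule.smul_mem _ _ (Submodule.mem_span_singleton_self o)
  have h1 : ∑ i, (∑ j, c j)⁻¹ * c i = 1 := by
    rw [← Finset.mul_sum, inv_mul_cancel₀ ht.ne']
  refine ⟨s, ∑ i, c i, _, Affine.Simplex.mem_closedInterior_iff.2
    ⟨fun i => (∑ j, c j)⁻¹ * c i, h1, fun i => mul_nonneg (inv_nonneg.2 ht.le) (hc i), rfl⟩,
    hs, ht, ?_⟩
  rw [homogenize_map_sum_smul L τ h1, Finset.smul_sum]
  congr 1
  refine Finset.sum_congr rfl fun i _ => ?_
  rw [smul_smul, ← mul_assoc, mul_inv_cancel₀ ht.ne', one_mul]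

/-- Avoiding the span of all generators but one keeps that generator's coefficient from vanishing;
normalizing the base coefficients then gives an interior point. -/
lemma exists_mem_relInterior_of_mem_cone {o z : Fin (m + 1) → ℝ}
    (hz : z ∈ nonnegCone (Fin.cons o (homVertices L τ) : Fin (n + 2) → Fin (m + 1) → ℝ))
    (hgen : ∀ i, z ∉ Submodule.span ℝ
      ((Fin.cons o (homVertices L τ) : Fin (n + 2) → Fin (m + 1) → ℝ) '' {i}ᶜ)) :
    ∃ s t : ℝ, ∃ x ∈ τ.relInterior, 0 < t ∧ s • o + t • homogenize (L x) = z := by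
  obtain ⟨s, c, hs, hc, rfl⟩ := (mem_nonnegCone_cons _ _ _).1 hz
  have hpos : ∀ i, 0 < c i := by
    refine fun i => lt_of_le_of_ne (hc i) fun h => hgen i.succ ?_
    refine Submodule.add_mem _ (Submodule.smul_mem _ _ (Submodule.subset_span ⟨0, ?_, rfl⟩))
      (Submodule.sum_mem _ fun j _ => ?_)
    · simpa using (Fin.succ_ne_zero i).symm
    · by_cases hj : j = i
      · rw [hj, ← h]
        simp
      · exact Submodule.smul_mem _ _ (Submodule.subset_span ⟨j.succ, by simpa using hj, rfl⟩)
  have ht : 0 < ∑ i, c i := Finset.sum_pos (fun i _ => hpos i) Finset.univ_nonempty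
  have h1 : ∑ i, (∑ j, c j)⁻¹ * c i = 1 := by
    rw [← Finset.mul_sum, inv_mul_cancel₀ ht.ne']
  refine ⟨s, ∑ i, c i, _, Affine.Simplex.mem_setInterior_iff.2
    ⟨fun i => (∑ j, c j)⁻¹ * c i, h1, fun i => mul_pos (inv_pos.2 ht) (hpos i), rfl⟩,
    ht, ?_⟩
  rw [homogenize_map_sum_smul L τ h1, Finset.smul_sum]
  congr 1
  refine Finset.sum_congr rfl fun i _ => ?_
  rw [smul_smul, ← mul_assoc, mul_inv_cancel₀ ht.ne', one_mul]

/-- Central projection from `o` is injective on a simplex in general position. -/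
lemma eq_of_cone_coordinates_eq {k : ℕ} (L : X →ₗ[ℝ] Fin (k + 1) → ℝ) (σ : Affine.Simplex ℝ X k)
    {o : Fin (k + 2) → ℝ}
    (hdet : Matrix.det (Fin.cons o (homVertices L σ) : Fin (k + 2) → Fin (k + 2) → ℝ) ≠ 0)
    {s t s' t' : ℝ} {x x' : X} (hx : x ∈ σ.closedInterior) (hx' : x' ∈ σ.closedInterior)
    (ht : 0 < t)
    (h : s • o + t • homogenize (L x) = s' • o + t' • homogenize (L x')) : x = x' := by
  obtain ⟨c, h1, -, rfl⟩ := Affine.Simplex.mem_closedInterior_iff.1 hx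
  obtain ⟨c', h1', -, rfl⟩ := Affine.Simplex.mem_closedInterior_iff.1 hx'
  rw [homogenize_map_sum_smul L σ h1, homogenize_map_sum_smul L σ h1', ← sub_eq_zero] at h
  have h2 := eq_zero_of_sum_smul_eq_zero hdet
    (c := Fin.cons (s - s') (fun i => t * c i - t' * c' i)) (by
      rw [← h, Fin.sum_univ_succ]
      simp only [Fin.cons_zero, Fin.cons_succ, sub_smul, Finset.sum_sub_distrib, mul_smul,
        Finset.smul_sum]
      abel)
  have h3 : ∀ i, t * c i = t' * c' i := fun i => by
    simpa [sub_eq_zero] using congrFun h2 i.succ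
  have h4 : t = t' := by
    have := Finset.sum_congr (rfl : Finset.univ = Finset.univ) fun i _ => h3 i
    rwa [← Finset.mul_sum, ← Finset.mul_sum, h1, h1', mul_one, mul_one] at this
  refine Finset.sum_congr rfl fun i _ => ?_
  have := h3 i
  rw [← h4] at this
  rw [mul_left_cancel₀ ht.ne' this]

lemma ncard_compl_singleton_fin (N : ℕ) (i : Fin (N + 1)) : ({i}ᶜ : Set (Fin (N + 1))).ncard = N := by
  rw [Set.ncard_compl, Set.ncard_singleton, Nat.card_fin, Nat.add_sub_cancel]

lemma ncard_compl_pair_fin (N : ℕ) {i j : Fin (N + 2)} (hij : i ≠ j) :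
    ({i, j}ᶜ : Set (Fin (N + 2))).ncard = N := by
  rw [Set.ncard_compl, Set.ncard_pair hij, Nat.card_fin, Nat.add_sub_cancel]

/-- The oriented cone over a simplex is almost everywhere the sum of the oriented cones over the
members of a partition. -/
lemma ae_coneIndex_eq_sum_of_isPartition {k r : ℕ} (ν : Measure (Fin (k + 1) → ℝ))
    [ν.IsAddHaarMeasure] (L : X →ₗ[ℝ] Fin (k + 1) → ℝ) (o : Fin (k + 2) → ℝ)
    {σ : Affine.Simplex ℝ X k} {τ : Fin r → Affine.Simplex ℝ X k} (h : σ.IsPartition τ) :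
    ∀ᵐ y ∂ν, coneIndex (Fin.cons o (homVertices L σ)) (homogenize y) =
      ∑ j, coneIndex (Fin.cons o (homVertices L (τ j))) (homogenize y) := by
  have hgen : ∀ᵐ y ∂ν, ∀ j i, homogenize y ∉ Submodule.span ℝ
      ((Fin.cons o (homVertices L (τ j)) : Fin (k + 2) → Fin (k + 2) → ℝ) '' {i}ᶜ) := by
    refine ae_all_iff.2 fun j => ae_all_iff.2 fun i => ?_
    exact ae_homogenize_notMem_span ν _ _ (ncard_compl_singleton_fin _ i).le
  have ho := ae_homogenize_notMem_span ν (fun _ : Unit => o) Set.univ (by simp)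
  filter_upwards [hgen, ho] with y hgen ho
  have ho' : homogenize y ∉ Submodule.span ℝ {o} := by simpa using ho
  set D := Matrix.det (Fin.cons o (homVertices L σ) : Fin (k + 2) → Fin (k + 2) → ℝ) with hD
  have hdet : ∀ j, ∃ a : ℝ, 0 < a ∧ Matrix.det
      (Fin.cons o (homVertices L (τ j)) : Fin (k + 2) → Fin (k + 2) → ℝ) = a * D := by
    intro j
    obtain ⟨M, hM1, hM, hMdet⟩ := h.sameOrientation j
    refine ⟨M.det, hMdet, ?_⟩
    rw [hD, ← det_cons_sum_smul]
    congr 2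
    funext i
    rw [homVertices, hM i, homogenize_map_sum_smul L σ (hM1 i)]
  have hsign : ∀ j, SignType.sign (Matrix.det
      (Fin.cons o (homVertices L (τ j)) : Fin (k + 2) → Fin (k + 2) → ℝ)) = SignType.sign D := by
    intro j
    obtain ⟨a, ha, hj⟩ := hdet j
    rw [hj, sign_mul, sign_pos ha, one_mul]
  -- All signs equal that of `D`; what remains is that the cones over the pieces tile the cone over
  -- `σ` up to a null set.
  simp only [coneIndex, hsign, ← hD]
  by_cases hD0 : D = 0
  · simp [hD0]
  have hsub : ∀ j, (τ j).closedInterior ⊆ σ.closedInterior := fun j =>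
    h.iUnion_eq ▸ Set.subset_iUnion (fun j => (τ j).closedInterior) j
  by_cases hy : homogenize y ∈
      nonnegCone (Fin.cons o (homVertices L σ) : Fin (k + 2) → Fin (k + 2) → ℝ)
  · obtain ⟨s, t, x, hx, hs, ht, hxy⟩ := exists_mem_closedInterior_of_mem_cone L σ hy ho'
    rw [← h.iUnion_eq] at hx
    obtain ⟨j₀, hj₀⟩ := Set.mem_iUnion.1 hx
    have hmem := mem_cone_of_mem_closedInterior L (τ j₀) (o := o) hs ht.le hj₀
    rw [hxy] at hmem
    rw [if_pos hy, Finset.sum_eq_single j₀, if_pos hmem]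
    · intro j _ hne
      refine if_neg fun hj => ?_
      -- If two pieces had `y` in their cones, central projection from `o` would give a common
      -- relative interior point.
      obtain ⟨s₁, t₁, x₁, hx₁, ht₁, h₁⟩ := exists_mem_relInterior_of_mem_cone L _ hj (hgen j)
      obtain ⟨s₂, t₂, x₂, hx₂, -, h₂⟩ := exists_mem_relInterior_of_mem_cone L _ hmem (hgen j₀)
      have := eq_of_cone_coordinates_eq L σ hD0
        (hsub _ ((τ j).relInterior_subset_closedInterior hx₁))
        (hsub _ ((τ j₀).relInterior_subset_closedInterior hx₂)) ht₁ (h₁.trans h₂.symm)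
      exact Set.disjoint_left.1 (h.nonoverlapping hne) hx₁ (this ▸ hx₂)
    · simp
  · rw [if_neg hy, Finset.sum_eq_zero]
    refine fun j _ => if_neg fun hj => hy ?_
    obtain ⟨s, t, x, hx, hs, ht, hxy⟩ := exists_mem_closedInterior_of_mem_cone L _ hj ho'
    rw [← hxy]
    exact mem_cone_of_mem_closedInterior L σ hs ht.le (hsub j hx)

/-- The oriented indicator function of a simplex is almost everywhere the sum of the oriented cones
over the faces. -/
lemma ae_coneIndex_homVertices_eq_sum {k : ℕ} (ν : Measure (Fin (k + 1) → ℝ))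
    [ν.IsAddHaarMeasure] (L : X →ₗ[ℝ] Fin (k + 1) → ℝ) (p : Fin (k + 1) → ℝ)
    [NeZero (k + 1)] (σ : Affine.Simplex ℝ X (k + 1)) :
    ∀ᵐ y ∂ν, coneIndex (homVertices L σ) (homogenize y) =
      ∑ i : Fin (k + 2), (-1) ^ (i : ℕ) *
        coneIndex (Fin.cons (homogenize p) (homVertices L (n := k) (σ.faceOpposite i)))
          (homogenize y) := by
  have hgen : ∀ᵐ y ∂ν, ∀ i j, i ≠ j → homogenize y ∉ Submodule.span ℝ
      ((Fin.cons (homogenize p) (homVertices L σ) : Fin (k + 3) → Fin (k + 2) → ℝ) ''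
        {i, j}ᶜ) := by
    refine ae_all_iff.2 fun i => ae_all_iff.2 fun j => ae_all_iff.2 fun hij => ?_
    exact ae_homogenize_notMem_span ν _ _ (ncard_compl_pair_fin _ hij).le
  filter_upwards [hgen] with y hgen
  -- The circuit is the apex followed by the vertices. Omitting the apex gives `σ`; omitting vertex
  -- `i` gives the cone over face `i`, with sign `(-1)^(i+1)` owing to the index shift.
  have h := sum_coneIndex_succAbove _ _ (LinearMap.proj 0)
    (fun i => by refine Fin.cases ?_ (fun i => ?_) i <;> simp [homVertices, homogenize]) hgen
  rw [Fin.sum_univ_succ] at h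
  have h0 : (fun j : Fin (k + 2) => (Fin.cons (homogenize p) (homVertices L σ) :
      Fin (k + 3) → Fin (k + 2) → ℝ) (Fin.succAbove 0 j)) = homVertices L σ := by
    funext j
    simp
  have hs : ∀ i : Fin (k + 2), (fun j : Fin (k + 2) => (Fin.cons (homogenize p) (homVertices L σ) :
      Fin (k + 3) → Fin (k + 2) → ℝ) (Fin.succAbove i.succ j)) =
      Fin.cons (homogenize p) (homVertices L (n := k) (σ.faceOpposite i)) := by
    intro i
    funext j
    refine Fin.cases ?_ (fun j => ?_) j
    · simp
    · rw [Fin.succ_succAbove_succ, Fin.cons_succ, Fin.cons_succ, homVertices, homVertices,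
        Affine.Simplex.faceOpposite_point_eq_point_succAbove]
      rfl
  simp only [h0, hs] at h
  simp only [Fin.val_zero, pow_zero, one_mul, Fin.val_succ, pow_succ, mul_neg, mul_one, neg_mul,
    Finset.sum_neg_distrib] at h
  linarith

end Simplex

/-! ### Multiplicity of a cycle in top dimension -/

section Cycle

variable {X : Type*} [NormedAddCommGroup X] [NormedSpace ℝ X] {G : Type*}

/-- The value at `y` of the multiplicity function of the cone over the image of a chain. -/
noncomputable def coneMultiplicity [AddCommGroup G] {k : ℕ} (L : X →ₗ[ℝ] Fin (k + 1) → ℝ)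
    (o y : Fin (k + 2) → ℝ) : FormalChain X G k →+ G :=
  Finsupp.liftAddHom fun τ => zsmulAddGroupHom (coneIndex (Fin.cons o (homVertices L τ)) y)

@[simp]
lemma coneMultiplicity_single [AddCommGroup G] {k : ℕ} (L : X →ₗ[ℝ] Fin (k + 1) → ℝ)
    (o y : Fin (k + 2) → ℝ) (τ : Affine.Simplex ℝ X k) (g : G) :
    coneMultiplicity L o y (Finsupp.single τ g) =
      coneIndex (Fin.cons o (homVertices L τ)) y • g := by
  simp [coneMultiplicity]

/-- Reorientations are killed at every point, partitions only almost everywhere. The null set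
depends on `c`, so the claim is made for one chain at a time. -/
lemma ae_coneMultiplicity_eq_zero [AddCommGroup G] {k : ℕ} (ν : Measure (Fin (k + 1) → ℝ))
    [ν.IsAddHaarMeasure] (L : X →ₗ[ℝ] Fin (k + 1) → ℝ) (o : Fin (k + 2) → ℝ)
    {c : FormalChain X G k} (hc : c ∈ chainRelations X G k) :
    ∀ᵐ y ∂ν, coneMultiplicity L o (homogenize y) c = 0 := by
  induction hc using AddSubgroup.closure_induction with
  | mem c hc =>
    rcases hc with ⟨g, σ, e, rfl⟩ | ⟨g, σ, r, τ, hτ, rfl⟩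
    · refine Filter.Eventually.of_forall fun y => ?_
      have h : homVertices L (σ.reindex e) = homVertices L σ ∘ e.symm := rfl
      rw [map_sub, coneMultiplicity_single, coneMultiplicity_single, h, coneIndex_cons_comp_perm,
        Equiv.Perm.sign_symm, mul_comm, mul_smul, sub_self]
    · filter_upwards [ae_coneIndex_eq_sum_of_isPartition ν L o hτ] with y hy
      rw [map_sub, map_sum]
      simp only [coneMultiplicity_single]
      rw [hy, Finset.sum_smul, sub_self]
  | zero => simp
  | add a b _ _ ha hb =>
    filter_upwards [ha, hb] with y ha hb
    rw [map_add, ha, hb, add_zero]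
  | neg a _ ha =>
    filter_upwards [ha] with y ha
    rw [map_neg, ha, neg_zero]

/-- The multiplicity function of the image of a cycle of top dimension vanishes almost
everywhere. -/
lemma ae_sum_coneIndex_smul_eq_zero [AddCommGroup G] {k κ : ℕ} [NeZero (k + 1)]
    (ν : Measure (Fin (k + 1) → ℝ)) [ν.IsAddHaarMeasure] (L : X →ₗ[ℝ] Fin (k + 1) → ℝ)
    (σ : Fin κ → Affine.Simplex ℝ X (k + 1)) (g : Fin κ → G)
    (h : ∑ j, elementaryBoundary (g j) (σ j) = 0) :
    ∀ᵐ y ∂ν, ∑ j, coneIndex (homVertices L (σ j)) (homogenize y) • g j = 0 := by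
  have hmem : ∑ j, ∑ i : Fin (k + 2), Finsupp.single ((σ j).faceOpposite i)
      (((-1 : ℤ) ^ (i : ℕ)) • g j) ∈ chainRelations X G k := by
    rw [← QuotientAddGroup.eq_zero_iff, ← h]
    simp only [elementaryBoundary, elementaryChain, ← QuotientAddGroup.mk'_apply, map_sum]
    rfl
  filter_upwards [ae_coneMultiplicity_eq_zero ν L (homogenize 0) hmem,
    ae_all_iff.2 fun j => ae_coneIndex_homVertices_eq_sum ν L 0 (σ j)] with y hy hj
  rw [← hy, map_sum]
  refine Finset.sum_congr rfl fun j _ => ?_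
  rw [map_sum, hj j, Finset.sum_smul]
  refine Finset.sum_congr rfl fun i _ => ?_
  rw [coneMultiplicity_single, smul_smul, mul_comm]

/-- The image of a degenerate simplex is a null set. -/
lemma measure_image_closedInterior_eq_zero {m : ℕ} (ν : Measure (Fin m → ℝ))
    [ν.IsAddHaarMeasure] (L : X →ₗ[ℝ] Fin m → ℝ) (τ : Affine.Simplex ℝ X m)
    (h : Matrix.det (homVertices L τ) = 0) : ν (L '' τ.closedInterior) = 0 := by
  obtain ⟨c, hc0, hc⟩ := Matrix.exists_vecMul_eq_zero_iff.2 h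
  obtain ⟨i, hi⟩ := Function.ne_iff.1 hc0
  have hsum : ∑ j, c j • homVertices L τ j = 0 := by
    rw [← hc]
    ext j
    simp [Matrix.vecMul, dotProduct]
  -- Vertex `i` depends on the others, so the whole cone lies in their span, which almost every
  -- point avoids.
  set U := Submodule.span ℝ (homVertices L τ '' {i}ᶜ)
  have hrest : ∀ j, j ≠ i → homVertices L τ j ∈ U := fun j hj =>
    Submodule.subset_span ⟨j, hj, rfl⟩
  have hiU : homVertices L τ i ∈ U := by
    have h1 : c i • homVertices L τ i ∈ U := by
      rw [← Finset.add_sum_erase _ _ (Finset.mem_univ i), ← eq_neg_iff_add_eq_zero] at hsum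
      rw [hsum]
      exact U.neg_mem (U.sum_mem fun j hj => U.smul_mem _ (hrest j (Finset.ne_of_mem_erase hj)))
    simpa [smul_smul, inv_mul_cancel₀ hi] using U.smul_mem (c i)⁻¹ h1
  refine measure_mono_null (fun y hy => ?_) (ae_iff.1
    (ae_homogenize_notMem_span ν (homVertices L τ) {i}ᶜ (ncard_compl_singleton_fin _ i).le))
  obtain ⟨a, -, ha⟩ := (homogenize_mem_nonnegCone_homVertices L τ).2 hy
  simp only [mem_ofPred_eq, not_not]
  rw [← ha]
  refine U.sum_mem fun j _ => U.smul_mem _ ?_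
  by_cases hj : j = i
  · exact hj ▸ hiU
  · exact hrest j hj

/-- The triangle inequality for the images of the simplices of a cycle in a space of the same
dimension. -/
lemma enorm_mul_measure_image_le_sum [NormedAddCommGroup G] {k κ : ℕ} [NeZero (k + 1)]
    (ν : Measure (Fin (k + 1) → ℝ)) [ν.IsAddHaarMeasure] (L : X →L[ℝ] Fin (k + 1) → ℝ)
    (σ : Fin (κ + 1) → Affine.Simplex ℝ X (k + 1)) (g : Fin (κ + 1) → G)
    (h : ∑ j, elementaryBoundary (g j) (σ j) = 0) :
    ‖g 0‖ₑ * ν (L '' (σ 0).closedInterior) ≤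
      ∑ j : Fin κ, ‖g j.succ‖ₑ * ν (L '' (σ j.succ).closedInterior) := by
  classical
  by_cases hdet : Matrix.det (homVertices (L : X →ₗ[ℝ] Fin (k + 1) → ℝ) (σ 0)) = 0
  · have := measure_image_closedInterior_eq_zero ν (L : X →ₗ[ℝ] Fin (k + 1) → ℝ) (σ 0) hdet
    rw [ContinuousLinearMap.coe_coe] at this
    rw [this, mul_zero]
    exact zero_le
  have hmeas : ∀ j, MeasurableSet (L '' (σ j).closedInterior) := fun j =>
    ((σ j).isCompact_closedInterior.image L.continuous).measurableSet
  have hint : ∀ j, ‖g j‖ₑ * ν (L '' (σ j).closedInterior) =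
      ∫⁻ y, (L '' (σ j).closedInterior).indicator (fun _ => ‖g j‖ₑ) y ∂ν := fun j => by
    rw [lintegral_indicator (hmeas j), setLIntegral_const]
  simp only [hint]
  rw [← lintegral_finsetSum _ fun j _ => measurable_const.indicator (hmeas _)]
  refine lintegral_mono_ae ?_
  filter_upwards [ae_sum_coneIndex_smul_eq_zero ν (L : X →ₗ[ℝ] Fin (k + 1) → ℝ) σ g h] with y hy
  by_cases hy0 : y ∈ L '' (σ 0).closedInterior
  · rw [indicator_of_mem hy0]
    have hbound : ∀ j, ‖coneIndex (homVertices (L : X →ₗ[ℝ] Fin (k + 1) → ℝ) (σ j))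
        (homogenize y) • g j‖ₑ ≤ (L '' (σ j).closedInterior).indicator (fun _ => ‖g j‖ₑ) y := by
      intro j
      by_cases hj : y ∈ L '' (σ j).closedInterior
      · rw [indicator_of_mem hj, coneIndex]
        split_ifs
        · rcases SignType.sign (Matrix.det (homVertices (L : X →ₗ[ℝ] Fin (k + 1) → ℝ) (σ j)))
            with _ | _ | _ <;> simp
        · simp
      · rw [indicator_of_notMem hj, coneIndex,
          if_neg (mt (homogenize_mem_nonnegCone_homVertices _ _).1 hj)]
        simp
    -- As the image of `σ 0` is nondegenerate, its index is `±1` here; all other indices have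
    -- absolute value at most one and vanish off the images.
    have h0 : ‖g 0‖ₑ = ‖coneIndex (homVertices (L : X →ₗ[ℝ] Fin (k + 1) → ℝ) (σ 0))
        (homogenize y) • g 0‖ₑ := by
      rw [coneIndex, if_pos ((homogenize_mem_nonnegCone_homVertices _ _).2 hy0)]
      rcases lt_or_gt_of_ne hdet with hd | hd <;> simp [hd]
    rw [Fin.sum_univ_succ, ← eq_neg_iff_add_eq_zero] at hy
    rw [h0, hy, enorm_neg]
    exact (enorm_sum_le _ _).trans (Finset.sum_le_sum fun j _ => hbound j.succ)
  · rw [indicator_of_notMem hy0]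
    exact zero_le

end Cycle

/-! ### Haar coordinates and density contractors -/

section Contractor

variable {X : Type*} [NormedAddCommGroup X]

/-- The measure of the image of a compact set is a Borel function of the linear map. -/
lemma measurable_measure_image {E F T : Type*} [TopologicalSpace E] [TopologicalSpace F]
    [T2Space F] [SecondCountableTopology F] [MeasurableSpace F] [BorelSpace F]
    [TopologicalSpace T] [T2Space T] [SecondCountableTopology T] [MeasurableSpace T] [BorelSpace T]
    (ν : Measure F) [SFinite ν] {f : T → E → F} (hf : Continuous fun p : T × E => f p.1 p.2)
    {K : Set E} (hK : IsCompact K) : Measurable fun t => ν (f t '' K) := by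
  -- The graph of `t ↦ f t '' K` is closed, being a projection along the compact factor `K`; the
  -- measure of its slices is then measurable.
  have hclosed : IsClosed {p : T × F | p.2 ∈ f p.1 '' K} := by
    have : CompactSpace K := isCompact_iff_compactSpace.1 hK
    have h1 : IsClosed {p : K × (T × F) | f p.2.1 p.1 = p.2.2} :=
      isClosed_eq (hf.comp (by fun_prop : Continuous fun p : K × (T × F) => (p.2.1, (p.1 : E))))
        (by fun_prop)
    convert isClosedMap_snd_of_compactSpace _ h1
    ext p
    simp [Set.mem_image]
  exact measurable_measure_prodMk_left hclosed.measurableSet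

/-- The direction of the affine plane of a simplex. -/
def Affine.Simplex.direction [NormedSpace ℝ X] {n : ℕ} (σ : Affine.Simplex ℝ X n) : Grassmannian X n :=
  ⟨vectorSpan ℝ (range σ.points), σ.independent.finrank_vectorSpan (by simp)⟩

lemma Affine.Simplex.translate_closedInterior_subset [NormedSpace ℝ X] {n : ℕ}
    (σ : Affine.Simplex ℝ X n) :
    (fun x => -σ.points 0 + x) '' σ.closedInterior ⊆ (σ.direction.1 : Set X) := by
  rintro _ ⟨x, hx, rfl⟩
  have h := vsub_mem_vectorSpan_of_mem_affineSpan_of_mem_affineSpan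
    (σ.closedInterior_subset_affineSpan hx) (mem_affineSpan ℝ (mem_range_self (f := σ.points) 0))
  rwa [vsub_eq_sub, sub_eq_neg_add] at h

variable [MeasurableSpace X] [BorelSpace X]

lemma normHausdorff_apply (m : ℕ) (A : Set X) :
    normHausdorff X m A =
      volume (Metric.ball (0 : EuclideanSpace ℝ (Fin m)) 1) / 2 ^ m * Measure.hausdorffMeasure m A :=
  rfl

lemma normHausdorff_vadd (m : ℕ) (v : X) (A : Set X) :
    normHausdorff X m ((fun x => v + x) '' A) = normHausdorff X m A := by
  rw [normHausdorff_apply, normHausdorff_apply]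
  congr 1
  exact (IsometryEquiv.addLeft v).hausdorffMeasure_image m A

/-- In linear coordinates on an `m`-dimensional subspace, the Hausdorff measure is a Haar
measure. -/
lemma exists_isAddHaarMeasure_normHausdorff [NormedSpace ℝ X] [FiniteDimensional ℝ X] {m : ℕ}
    (W : Grassmannian X m) :
    ∃ (q : X →L[ℝ] Fin m → ℝ) (ν : Measure (Fin m → ℝ)), ν.IsAddHaarMeasure ∧
      ∀ A ⊆ (W.1 : Set X), normHausdorff X m A = ν (q '' A) := by
  let e : W.1 ≃L[ℝ] (Fin m → ℝ) := ContinuousLinearEquiv.ofFinrankEq (by simp [W.2])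
  -- A linear projection onto `W` extends the coordinates to all of `X`, so that they compose with
  -- every `π`.
  obtain ⟨p, hp⟩ := LinearMap.exists_leftInverse_of_injective W.1.subtype W.1.ker_subtype
  let c := volume (Metric.ball (0 : EuclideanSpace ℝ (Fin m)) 1) / 2 ^ m
  have hc0 : c ≠ 0 := ENNReal.div_ne_zero.2
    ⟨(Metric.measure_ball_pos _ _ one_pos).ne', ENNReal.pow_ne_top ENNReal.ofNat_ne_top⟩
  have hc : c ≠ ∞ := ENNReal.div_ne_top measure_ball_lt_top.ne (by simp)
  have hHaar : (Measure.hausdorffMeasure m : Measure W.1).IsAddHaarMeasure := by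
    have := isAddHaarMeasure_hausdorffMeasure (E := W.1)
    rwa [W.2] at this
  refine ⟨(e : W.1 →L[ℝ] Fin m → ℝ).comp (LinearMap.toContinuousLinearMap p),
    c • (Measure.hausdorffMeasure m : Measure W.1).map e,
    Measure.IsAddHaarMeasure.smul _ hc0 hc, fun A hA => ?_⟩
  have hpA : e.symm '' (((e : W.1 →L[ℝ] Fin m → ℝ).comp (LinearMap.toContinuousLinearMap p)) '' A)
      = W.1.subtype ⁻¹' A := by
    rw [image_image]
    ext x
    constructor
    · rintro ⟨a, ha, rfl⟩
      have : p a = ⟨a, hA ha⟩ := DFunLike.congr_fun hp ⟨a, hA ha⟩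
      simpa [this] using ha
    · intro hx
      exact ⟨x, hx, by simpa using DFunLike.congr_fun hp x⟩
  have hmap : (Measure.hausdorffMeasure m : Measure W.1).map e (((e : W.1 →L[ℝ] Fin m → ℝ).comp
      (LinearMap.toContinuousLinearMap p)) '' A) = Measure.hausdorffMeasure m A := by
    refine (MeasurableEquiv.map_apply e.toHomeomorph.toMeasurableEquiv _).trans ?_
    have h : (e.toHomeomorph.toMeasurableEquiv : W.1 → Fin m → ℝ) = e := rfl
    rw [h, ← e.image_symm_eq_preimage, hpA,
      ← W.1.subtypeₗᵢ.isometry.hausdorffMeasure_image (Or.inl (Nat.cast_nonneg m))]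
    congr 1
    simpa [image_preimage_eq_inter_range] using hA
  rw [normHausdorff_apply, Measure.smul_apply, smul_eq_mul, hmap]

variable [NormedSpace ℝ X]

/-- Contractors are tested on subsets of linear subspaces; this moves an affine simplex into its
direction without changing the area of its images. -/
lemma normHausdorff_map_translate (m : ℕ) (f : X →L[ℝ] X) (v : X) (A : Set X) :
    normHausdorff X m (f '' ((fun x => v + x) '' A)) = normHausdorff X m (f '' A) := by
  rw [← normHausdorff_vadd m (f v) (f '' A), image_image, image_image]
  simp only [map_add]

/-- Density contractors do not increase the area of simplices. -/
lemma IsDensityContractor.lintegral_simplex_le {m : ℕ} {W : Grassmannian X m}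
    {μ : Measure (HomRankLE X m)} (hμ : IsDensityContractor W μ) (σ : Affine.Simplex ℝ X m) :
    ∫⁻ π, normHausdorff X m (π.1 '' σ.closedInterior) ∂μ ≤
      normHausdorff X m σ.closedInterior := by
  have h := hμ.contracts σ.direction _
    (σ.isCompact_closedInterior.image (continuous_const_add (-σ.points 0))).measurableSet
    σ.translate_closedInterior_subset
  simpa only [normHausdorff_map_translate, normHausdorff_vadd] using h

lemma IsDensityContractor.lintegral_simplex_eq {m : ℕ} (σ : Affine.Simplex ℝ X m)
    {μ : Measure (HomRankLE X m)} (hμ : IsDensityContractor σ.direction μ) :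
    ∫⁻ π, normHausdorff X m (π.1 '' σ.closedInterior) ∂μ =
      normHausdorff X m σ.closedInterior := by
  have h := hμ.eq_on _
    (σ.isCompact_closedInterior.image (continuous_const_add (-σ.points 0))).measurableSet
    σ.translate_closedInterior_subset
  simpa only [normHausdorff_map_translate, normHausdorff_vadd] using h

end Contractor

/-! ### Integration over the contractor -/

theorem mainTheorem5 {X : Type*} [NormedAddCommGroup X] [NormedSpace ℝ X] [FiniteDimensional ℝ X]
    [MeasurableSpace X] [BorelSpace X] (m : ℕ) [NeZero m] (hm : m < Module.finrank ℝ X)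
    (hcontr : ∀ W : Grassmannian X m, ∃ μ : MeasureTheory.Measure (HomRankLE X m),
      IsDensityContractor W μ) :
    ∀ (G : Type*) [NormedAddCommGroup G] [CompleteSpace G],
      TriangleInequalityForCycles X G m := by
  intro G _ _ κ σ g h
  obtain ⟨k, rfl⟩ := Nat.exists_eq_succ_of_ne_zero (NeZero.ne m)
  obtain ⟨μ, hμ⟩ := hcontr (σ 0).direction
  obtain ⟨q, ν, hν, hq⟩ := exists_isAddHaarMeasure_normHausdorff (σ 0).direction
  have hF : ∀ᵐ π ∂μ, ∀ j, normHausdorff X (k + 1) (π.1 '' (σ j).closedInterior) =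
      ν ((q.comp π.1) '' (σ j).closedInterior) := by
    have hsupp : ∀ᵐ π ∂μ, (π.1 : X →ₗ[ℝ] X).range ≤ (σ 0).direction.1 := ae_iff.2 hμ.supported
    filter_upwards [hsupp] with π hπ j
    rw [hq _ (by rintro _ ⟨x, -, rfl⟩; exact hπ ⟨x, rfl⟩), image_image]
    rfl
  -- Measurability lets the constants and the finite sum pass through the lower integrals.
  have hmeas : ∀ j, Measurable fun π : HomRankLE X (k + 1) =>
      ν ((q.comp π.1) '' (σ j).closedInterior) := fun j => by
    exact measurable_measure_image ν (f := fun (π : HomRankLE X (k + 1)) x => q (π.1 x))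
      (by fun_prop) (σ j).isCompact_closedInterior
  have hint : ∀ j, ∫⁻ π, normHausdorff X (k + 1) (π.1 '' (σ j).closedInterior) ∂μ =
      ∫⁻ π, ν ((q.comp π.1) '' (σ j).closedInterior) ∂μ := fun j =>
    lintegral_congr_ae (hF.mono fun π hπ => hπ j)
  calc elementaryMass (g 0) (σ 0)
      = ∫⁻ π, ‖g 0‖ₑ * ν ((q.comp π.1) '' (σ 0).closedInterior) ∂μ := by
        rw [elementaryMass, ← hμ.lintegral_simplex_eq, hint, lintegral_const_mul _ (hmeas 0)]
    _ ≤ ∫⁻ π, ∑ j : Fin κ, ‖g j.succ‖ₑ * ν ((q.comp π.1) '' (σ j.succ).closedInterior) ∂μ :=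
        lintegral_mono fun π => enorm_mul_measure_image_le_sum ν (q.comp π.1) σ g h
    _ = ∑ j : Fin κ, ‖g j.succ‖ₑ * ∫⁻ π, ν ((q.comp π.1) '' (σ j.succ).closedInterior) ∂μ := by
        rw [lintegral_finsetSum _ fun j _ => (hmeas _).const_mul _]
        exact Finset.sum_congr rfl fun j _ => lintegral_const_mul _ (hmeas _)
    _ ≤ ∑ j : Fin κ, elementaryMass (g j.succ) (σ j.succ) := by
        refine Finset.sum_le_sum fun j _ => mul_le_mul_right ?_ _
        rw [← hint]
        exact hμ.lintegral_simplex_le _
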